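/- Theorem 2.1. For every $d$ there is a constant $K>0$, depending only on $d$, such that the following holds. Let $n\ge 1$ and $r\ge 2$ be integers, let $P$ be a set of $n$ points in $\mathbb{R}^d$, and let $L$ be a set of lines in $\mathbb{R}^d$, each of which contains at least $r$ points of $P$. If $$|L|\ \ge\ K\,\frac{n^2}{r^{d+1}},$$ then there is a hypersurface of degree at most $\frac r4$, i.e. the real zero set $\{x\in\mathbb{R}^d : f(x)=0\}$ of a nonconstant polynomial $f\in\mathbb{R}[x_1,\dots,x_d]$ of total degree at most $\frac r4$, that contains at least $4\,\frac{n^2}{r^{d+1}}$ lines of $L$. -/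

import Mathlib

/-- A line in `ℝ^d`: an affine subspace whose direction is one-dimensional (in particular it is
nonempty, as the empty affine subspace has zero direction). -/
def IsLine {d : ℕ} (l : AffineSubspace ℝ (Fin d → ℝ)) : Prop :=
  Module.finrank ℝ l.direction = 1

/-- `Z` is a real hypersurface in `ℝ^d` of degree at most `δ`: the real zero set of a nonconstant
real polynomial in `d` variables of total degree at most `δ`. -/
def IsHypersurfaceOfDegreeLE {d : ℕ} (Z : Set (Fin d → ℝ)) (δ : ℝ) : Prop :=
  ∃ f : MvPolynomial (Fin d) ℝ,
    0 < f.totalDegree ∧ (f.totalDegree : ℝ) ≤ δ ∧ Z = {x | MvPolynomial.eval x f = 0}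

/-! Polynomial partitioning, counted by pairs. Take `f` of degree at most `C * 2 ^ s` such that at
most `8 n² / 2 ^ (s d)` pairs of points are joined by a segment avoiding its zero set, with `2 ^ s`
comparable to `r`, so that the degree is at most `r / 4`. A rich line outside the zero set meets it
at most `deg f` times, so its points fall into few intervals and yield at least `r / 4` such pairs.
Different lines use different pairs, hence only `O(n² / r ^ (d + 1))` lines escape; all others lie
in the zero set.

The partition avoids ham sandwich theorems. Monomials of degree below `j` in each variable map `P`
into dimension `m = j ^ d`, where polynomials become linear forms. A random hyperplane separates two
vectors at an angle between 45° and 135° with probability at least 1/4. A linear change of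
coordinates making the vectors nearly isotropic (`exists_det_ne_zero_sum_inner_sq_div_le`) leaves at
most `4 n² / m` other pairs; vectors concentrated on a subspace are first projected suitably.
Multiplying such polynomials at dyadic scales gives `exists_partitioning_mvPolynomial`. -/

open MeasureTheory Metric Module

/-! ### Random hyperplanes separate far from parallel pairs -/

section Splitting

variable {E : Type*} [NormedAddCommGroup E] [InnerProductSpace ℝ E] [FiniteDimensional ℝ E]
  [MeasurableSpace E] [BorelSpace E]

/-- Write `v = ρ u + ‖w‖ e` with `e` a unit vector orthogonal to `u`; the hypothesis gives `|ρ| ≤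
‖w‖`. The isometries generated by `u ↦ -u` and by swapping `u` and `e` provide four preimages of the
separating region, of equal volume, which cover the punctured ball. -/
theorem volume_le_four_mul_inner_mul_inner_nonpos {u v : E} (hu : ‖u‖ = 1) (hv : ‖v‖ = 1)
    (h : inner ℝ u v ^ 2 ≤ 1 / 2) :
    volume (ball (0 : E) 1 \ {0}) ≤
      4 * volume ((ball (0 : E) 1 \ {0}) ∩ {x | inner ℝ x u * inner ℝ x v ≤ 0}) := by
  set D : Set E := ball (0 : E) 1 \ {0} with hD
  set G : Set E := D ∩ {x | inner ℝ x u * inner ℝ x v ≤ 0} with hG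
  have hGm : MeasurableSet G := by
    refine (measurableSet_ball.diff (measurableSet_singleton 0)).inter ?_
    exact measurableSet_le (by fun_prop) measurable_const
  have key : ∀ R : E ≃ₗᵢ[ℝ] E, volume (R ⁻¹' G) = volume G := fun R =>
    R.measurePreserving.measure_preimage hGm.nullMeasurableSet
  have hDR : ∀ (R : E ≃ₗᵢ[ℝ] E) (x : E), x ∈ D → R x ∈ D := by
    intro R x hx
    simpa [hD] using hx
  set ρ : ℝ := inner ℝ u v with hρ
  set w : E := v - ρ • u with hw
  have huu : inner ℝ u u = (1 : ℝ) := by rw [real_inner_self_eq_norm_sq, hu]; norm_num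
  have hvv : inner ℝ v v = (1 : ℝ) := by rw [real_inner_self_eq_norm_sq, hv]; norm_num
  have huw : inner ℝ u w = (0 : ℝ) := by
    rw [hw, inner_sub_right, inner_smul_right, huu, ← hρ]; ring
  have hww : ‖w‖ ^ 2 = 1 - ρ ^ 2 := by
    rw [← real_inner_self_eq_norm_sq]
    conv_lhs => rw [hw]
    rw [inner_sub_left, inner_smul_left, huw, inner_sub_right, hvv, inner_smul_right,
      real_inner_comm, ← hρ]
    simp; ring
  have hs : |ρ| ≤ ‖w‖ := by
    refine abs_le_of_sq_le_sq ?_ (norm_nonneg _)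
    nlinarith
  have hs0 : 0 < ‖w‖ := by
    rcases (norm_nonneg w).eq_or_lt with h0 | h0
    · rw [← h0] at hww; nlinarith
    · exact h0
  set e : E := ‖w‖⁻¹ • w with he
  have hen : ‖e‖ = 1 := by rw [he, norm_smul]; simp [hs0.ne']
  have hue : inner ℝ u e = (0 : ℝ) := by rw [he, inner_smul_right, huw, mul_zero]
  have hve : v = ρ • u + ‖w‖ • e := by
    rw [he, smul_smul, mul_inv_cancel₀ hs0.ne', one_smul, hw]; abel
  let R₁ : E ≃ₗᵢ[ℝ] E := (Submodule.span ℝ {u})ᗮ.reflection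
  let R₂ : E ≃ₗᵢ[ℝ] E := (Submodule.span ℝ {u - e})ᗮ.reflection
  have h1 : ∀ x y : E, inner ℝ (R₁ x) y = inner ℝ x (R₁ y) := fun x y => by
    conv_lhs => rw [← (Submodule.span ℝ {u})ᗮ.reflection_reflection y]
    exact R₁.inner_map_map _ _
  have h2 : ∀ x y : E, inner ℝ (R₂ x) y = inner ℝ x (R₂ y) := fun x y => by
    conv_lhs => rw [← (Submodule.span ℝ {u - e})ᗮ.reflection_reflection y]
    exact R₂.inner_map_map _ _
  have h1u : R₁ u = -u := Submodule.reflection_orthogonalComplement_singleton_eq_neg u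
  have h1e : R₁ e = e := by
    apply Submodule.reflection_mem_subspace_eq_self
    rw [Submodule.mem_orthogonal_singleton_iff_inner_right]; exact hue
  have h2u : R₂ u = e := Submodule.reflection_sub (by rw [hu, hen])
  have h2e : R₂ e = u := by
    rw [← h2u]; exact Submodule.reflection_reflection _ _
  have hcov : D ⊆ (G ∪ R₁ ⁻¹' G) ∪ (R₂ ⁻¹' G ∪ (R₂.trans R₁) ⁻¹' G) := by
    intro x hx
    have hx2 : R₁ (R₂ x) ∈ D := hDR _ _ (hDR _ _ hx)
    simp only [Set.mem_union, Set.mem_preimage, hG, Set.mem_inter_iff, hDR _ _ hx, hx, hx2,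
      true_and, Set.mem_ofPred_eq, hve, inner_add_right, inner_smul_right, h1, h2, h1u, h2u, h1e, h2e,
      LinearIsometryEquiv.trans_apply, map_neg, inner_neg_right]
    set X : ℝ := inner ℝ x u
    set Y : ℝ := inner ℝ x e
    set s : ℝ := ‖w‖
    -- The cross term dominates because `|ρ| ≤ s` and `|a| ≤ |b|`. The swap arranges `|a| ≤ |b|`,
    -- the sign change arranges `a * b ≤ 0`.
    have hA : ∀ a b : ℝ, |a| ≤ |b| → a * b ≤ 0 → a * (ρ * a + s * b) ≤ 0 := by
      intro a b hab hab0
      have e1 : a * b = -(|a| * |b|) := by rw [← abs_mul, abs_of_nonpos hab0]; ring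
      have e2 : ρ * a ^ 2 ≤ |ρ| * |a| ^ 2 := by
        rw [sq_abs]; exact mul_le_mul_of_nonneg_right (le_abs_self _) (sq_nonneg _)
      have e3 : |ρ| * |a| ^ 2 ≤ s * (|a| * |b|) := by
        rw [sq]
        exact mul_le_mul hs (mul_le_mul_of_nonneg_left hab (abs_nonneg _)) (by positivity)
          hs0.le
      nlinarith
    have hB : ∀ a b : ℝ, |a| ≤ |b| →
        a * (ρ * a + s * b) ≤ 0 ∨ -a * (ρ * -a + s * b) ≤ 0 := by
      intro a b hab
      rcases le_total (a * b) 0 with h0 | h0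
      · exact Or.inl (hA a b hab h0)
      · exact Or.inr (hA (-a) b (by rwa [abs_neg]) (by linarith))
    rcases le_total |X| |Y| with h0 | h0
    · exact Or.inl (hB X Y h0)
    · exact Or.inr (hB Y X h0)
  calc volume D ≤ volume ((G ∪ R₁ ⁻¹' G) ∪ (R₂ ⁻¹' G ∪ (R₂.trans R₁) ⁻¹' G)) :=
        measure_mono hcov
    _ ≤ (volume G + volume (R₁ ⁻¹' G)) + (volume (R₂ ⁻¹' G) + volume ((R₂.trans R₁) ⁻¹' G)) :=
        (measure_union_le _ _).trans (add_le_add (measure_union_le _ _) (measure_union_le _ _))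
    _ = 4 * volume G := by rw [key, key, key]; ring

open Classical in
/-- For unit vectors, some point of the space splits a quarter of the far from parallel pairs. -/
theorem exists_splitting_of_norm_eq_one [Nontrivial E] {ι : Type*} (u : ι → E)
    (hu : ∀ i, ‖u i‖ = 1) (Q : Finset (ι × ι)) :
    ∃ x : E, x ≠ 0 ∧
      ((Q.filter fun p => inner ℝ (u p.1) (u p.2) ^ 2 ≤ 1 / 2).card : ℝ) / 4 ≤
        ((Q.filter fun p => inner ℝ x (u p.1) * inner ℝ x (u p.2) ≤ 0).card : ℝ) := by
  set D : Set E := ball (0 : E) 1 \ {0} with hD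
  set Q' := Q.filter fun p => inner ℝ (u p.1) (u p.2) ^ 2 ≤ 1 / 2 with hQ'
  let G : ι × ι → Set E := fun p => {x | inner ℝ x (u p.1) * inner ℝ x (u p.2) ≤ 0}
  have hGm : ∀ p, MeasurableSet (G p) := fun p =>
    measurableSet_le (by fun_prop) measurable_const
  have hD0 : volume D ≠ 0 := by
    have : volume D = volume (ball (0 : E) 1) := measure_sdiff_null (by simp)
    rw [this]
    exact (measure_ball_pos _ _ one_pos).ne'
  have hDt : volume D ≠ ⊤ :=
    ((measure_mono Set.sdiff_subset).trans_lt (measure_ball_lt_top (x := (0 : E)) (r := 1))).ne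
  -- Some `x` in the punctured ball attains at least the average of this count, which is at least
  -- `Q'.card / 4`.
  let f : E → ℝ := fun x => ∑ p ∈ Q', (G p).indicator (fun _ => (1 : ℝ)) x
  have hint : ∀ p, IntegrableOn ((G p).indicator fun _ => (1 : ℝ)) D volume := fun p =>
    (integrableOn_const hDt).indicator (hGm p)
  obtain ⟨x, hxD, hx⟩ := exists_setAverage_le (f := f) hD0 hDt
    (integrable_finsetSum _ fun p _ => hint p)
  refine ⟨x, hxD.2, ?_⟩
  have hfx : f x ≤ ((Q.filter fun p => inner ℝ x (u p.1) * inner ℝ x (u p.2) ≤ 0).card : ℝ) := by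
    have : f x = ((Q'.filter fun p => x ∈ G p).card : ℝ) := by
      simp only [f, Set.indicator_apply, Finset.sum_boole]
    rw [this]
    exact_mod_cast Finset.card_le_card
      (Finset.filter_subset_filter _ (Finset.filter_subset _ _))
  refine le_trans ?_ (hx.trans hfx)
  rw [setAverage_eq, integral_finsetSum _ fun p _ => hint p, smul_eq_mul]
  have hpos : 0 < volume.real D := ENNReal.toReal_pos hD0 hDt
  rw [inv_mul_eq_div, le_div_iff₀ hpos]
  have : ∀ p ∈ Q', volume.real D / 4 ≤ ∫ a in D, (G p).indicator (fun _ => (1 : ℝ)) a := by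
    intro p hp
    rw [integral_indicator (hGm p), Measure.restrict_restrict (hGm p)]
    have h4 := volume_le_four_mul_inner_mul_inner_nonpos (hu p.1) (hu p.2)
      (Finset.mem_filter.1 hp).2
    have hle : volume (D ∩ G p) ≠ ⊤ := measure_ne_top_of_subset Set.inter_subset_left hDt
    have h5 := ENNReal.toReal_mono (ENNReal.mul_ne_top (by simp) hle) h4
    rw [ENNReal.toReal_mul] at h5
    rw [integral_const, measureReal_restrict_apply_univ, Set.inter_comm, smul_eq_mul, mul_one]
    have h6 : volume.real D ≤ 4 * volume.real (D ∩ G p) := by simpa [Measure.real] using h5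
    linarith
  calc (Q'.card : ℝ) / 4 * volume.real D = ∑ p ∈ Q', volume.real D / 4 := by
        rw [Finset.sum_const, nsmul_eq_mul]; ring
    _ ≤ _ := Finset.sum_le_sum this

end Splitting

/-! ### Approximate radial isotropic position -/

section RadialIsotropy

/-- Greedy choice of a linearly independent subfamily, the vectors being taken by increasing
weight, compared with a fractional choice `c` in the matroid polytope. -/
theorem exists_linearIndepOn_sum_sub_le {ι E : Type*} [DecidableEq ι] [AddCommGroup E]
    [Module ℝ E] [FiniteDimensional ℝ E] (v : ι → E) (a : ι → ℝ) {c : ℝ}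
    (s : Finset ι)
    (h : ∀ (W : Submodule ℝ E) (t : Finset ι), t ⊆ s → (∀ i ∈ t, v i ∈ W) →
      c * t.card ≤ finrank ℝ W) :
    ∃ S ⊆ s, LinearIndepOn ℝ v (S : Set ι) ∧
      (∀ i ∈ s, v i ∈ Submodule.span ℝ (v '' (S : Set ι))) ∧
      ∀ b, (∀ i ∈ s, a i ≤ b) →
        ∑ i ∈ S, a i - c * ∑ i ∈ s, a i ≤ (S.card - c * s.card) * b := by
  induction s using Finset.induction_on_max_value a with
  | empty => exact ⟨∅, by simp⟩
  | insert p s hps hmax ih =>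
    obtain ⟨S, hSs, hind, hspan, hle⟩ :=
      ih fun W t ht hW => h W t (ht.trans (Finset.subset_insert _ _)) hW
    have hpS : p ∉ S := fun hp => hps (hSs hp)
    have hcard : ∀ T : Finset ι, LinearIndepOn ℝ v (T : Set ι) →
        (∀ i ∈ insert p s, v i ∈ Submodule.span ℝ (v '' (T : Set ι))) →
        c * (s.card + 1) ≤ T.card := by
      intro T hT hsp
      have h1 := h _ (insert p s) subset_rfl hsp
      have h2 : finrank ℝ (Submodule.span ℝ (v '' (T : Set ι))) = T.card := by
        have := finrank_span_eq_card hT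
        rw [← Set.image_eq_range] at this
        simpa using this
      rw [h2, Finset.card_insert_of_notMem hps] at h1
      exact_mod_cast h1
    -- As `p` has maximal weight, `a p` is an admissible bound. The slack `S.card - c * s.card`
    -- stays nonnegative by `hcard`, so `a p` may then be raised to any larger `b`.
    have hb := hle (a p) hmax
    by_cases hp : v p ∈ Submodule.span ℝ (v '' (S : Set ι))
    · have hsp : ∀ i ∈ insert p s, v i ∈ Submodule.span ℝ (v '' (S : Set ι)) := by
        intro i hi
        rcases Finset.mem_insert.1 hi with rfl | hi
        exacts [hp, hspan i hi]
      refine ⟨S, hSs.trans (Finset.subset_insert _ _), hind, hsp, fun b hbb => ?_⟩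
      have h1 := hcard S hind hsp
      have h2 := hbb p (Finset.mem_insert_self _ _)
      rw [Finset.sum_insert hps, Finset.card_insert_of_notMem hps]
      push_cast
      nlinarith
    · have hind' : LinearIndepOn ℝ v ((insert p S : Finset ι) : Set ι) := by
        rw [Finset.coe_insert]
        exact hind.insert hp
      have hsp : ∀ i ∈ insert p s,
          v i ∈ Submodule.span ℝ (v '' ((insert p S : Finset ι) : Set ι)) := by
        intro i hi
        rcases Finset.mem_insert.1 hi with rfl | hi
        · exact Submodule.subset_span ⟨i, by simp, rfl⟩
        · refine Submodule.span_mono (Set.image_mono ?_) (hspan i hi)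
          simp
      refine ⟨insert p S, Finset.insert_subset_insert _ hSs, hind', hsp, fun b hbb => ?_⟩
      have h1 := hcard _ hind' hsp
      have h2 := hbb p (Finset.mem_insert_self _ _)
      rw [Finset.card_insert_of_notMem hpS] at h1
      rw [Finset.sum_insert hps, Finset.sum_insert hpS, Finset.card_insert_of_notMem hps,
        Finset.card_insert_of_notMem hpS]
      push_cast at h1 ⊢
      nlinarith

variable {E : Type*} [NormedAddCommGroup E] [InnerProductSpace ℝ E]

/-- Hadamard's inequality. -/
theorem OrthonormalBasis.abs_toBasis_det_le {m : ℕ} (b : OrthonormalBasis (Fin m) ℝ E)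
    (v : Fin m → E) : |b.toBasis.det v| ≤ ∏ i, ‖v i‖ := by
  have : Fact (finrank ℝ E = m) := ⟨by simpa using finrank_eq_card_basis b.toBasis⟩
  rw [← b.toBasis.orientation.volumeForm_robust' b]
  exact b.toBasis.orientation.abs_volumeForm_apply_le v

variable [FiniteDimensional ℝ E]

/-- The greedy set for the weights `log ‖A (v i)‖` is a basis with zero slack, so its weight is at
most `c` times the total. Hadamard's inequality bounds that weight below by `log |det A|` plus a
term independent of `A`. -/
theorem exists_le_sum_log_norm_sub_log_abs_det {ι : Type*} [Fintype ι] (v : ι → E)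
    (hv : ∀ i, v i ≠ 0) {c : ℝ} (hcn : c * Fintype.card ι = finrank ℝ E)
    (h : ∀ (W : Submodule ℝ E) (t : Finset ι), (∀ i ∈ t, v i ∈ W) →
      c * t.card ≤ finrank ℝ W) :
    ∃ C : ℝ, ∀ A : E →ₗ[ℝ] E, LinearMap.det A ≠ 0 →
      C ≤ c * ∑ i, Real.log ‖A (v i)‖ - Real.log |LinearMap.det A| := by
  classical
  let b := stdOrthonormalBasis ℝ E
  -- One constant serves every basis chosen from the family; dependent tuples contribute `Real.log 0
  -- = 0`.
  refine ⟨-∑ g : Fin (finrank ℝ E) → ι, |Real.log (|b.toBasis.det (v ∘ g)|)|, fun A hA => ?_⟩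
  obtain ⟨S, -, hind, hspan, hle⟩ := exists_linearIndepOn_sum_sub_le v
    (fun i => Real.log ‖A (v i)‖) Finset.univ fun W t _ hW => h W t hW
  have hrank : finrank ℝ (Submodule.span ℝ (v '' (S : Set ι))) = S.card := by
    have := finrank_span_eq_card hind
    rw [← Set.image_eq_range] at this
    simpa using this
  have hSc : S.card = finrank ℝ E := by
    refine le_antisymm (hrank ▸ Submodule.finrank_le _) ?_
    have h1 := h _ Finset.univ hspan
    rw [hrank, Finset.card_univ, hcn] at h1
    exact_mod_cast h1
  have hsum : ∑ i ∈ S, Real.log ‖A (v i)‖ ≤ c * ∑ i, Real.log ‖A (v i)‖ := by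
    have h1 := hle (∑ i, |Real.log ‖A (v i)‖|) fun i hi => (le_abs_self _).trans
      (Finset.single_le_sum (f := fun i => |Real.log ‖A (v i)‖|) (fun _ _ => abs_nonneg _) hi)
    rw [hSc, Finset.card_univ, hcn, sub_self, zero_mul] at h1
    linarith
  let e : Fin (finrank ℝ E) ≃ S := (Finset.equivFinOfCardEq hSc).symm
  let g : Fin (finrank ℝ E) → ι := fun k => e k
  have hgind : LinearIndependent ℝ (v ∘ g) := hind.comp e e.injective
  have hdet : b.toBasis.det (v ∘ g) ≠ 0 := by
    have hb : IsUnit (b.toBasis.det (v ∘ g)) :=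
      b.toBasis.is_basis_iff_det.1 ⟨hgind,
        Submodule.eq_top_of_finrank_eq (by rw [finrank_span_eq_card hgind, Fintype.card_fin])⟩
    exact hb.ne_zero
  have hker : ∀ x, A x = 0 → x = 0 := by
    intro x hx
    exact (LinearMap.equivOfDetNeZero A hA).injective (by simpa using hx)
  have hsumS : ∑ i ∈ S, Real.log ‖A (v i)‖ = Real.log (∏ k, ‖A (v (g k))‖) := by
    rw [Real.log_prod fun k _ => norm_ne_zero_iff.2 fun h0 => hv _ (hker _ h0)]
    rw [← Finset.sum_coe_sort S]
    exact (e.sum_comp fun i : S => Real.log ‖A (v i)‖).symm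
  have hHad : |LinearMap.det A| * |b.toBasis.det (v ∘ g)| ≤ ∏ k, ‖A (v (g k))‖ := by
    rw [← abs_mul, ← Basis.det_comp]
    exact b.abs_toBasis_det_le _
  have hlog := Real.log_le_log (mul_pos (abs_pos.2 hA) (abs_pos.2 hdet)) hHad
  rw [Real.log_mul (abs_pos.2 hA).ne' (abs_pos.2 hdet).ne', ← hsumS] at hlog
  have h2 := Finset.single_le_sum (f := fun g : Fin (finrank ℝ E) → ι =>
    |Real.log (|b.toBasis.det (v ∘ g)|)|) (fun _ _ => abs_nonneg _) (Finset.mem_univ g)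
  have h3 := neg_abs_le (Real.log |b.toBasis.det (v ∘ g)|)
  linarith

/-- Vectors that do not accumulate on subspaces can be brought by a linear map into approximately
radial isotropic position. -/
theorem exists_det_ne_zero_sum_inner_sq_div_le {ι : Type*} [Fintype ι] (v : ι → E)
    (hv : ∀ i, v i ≠ 0) {c : ℝ} (hc : 0 ≤ c) (hcn : c * Fintype.card ι = finrank ℝ E)
    (h : ∀ (W : Submodule ℝ E) (t : Finset ι), (∀ i ∈ t, v i ∈ W) →
      c * t.card ≤ finrank ℝ W) :
    ∃ A : E →ₗ[ℝ] E, LinearMap.det A ≠ 0 ∧ ∀ e : E, ‖e‖ = 1 →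
      c * ∑ i, inner ℝ e (A (v i)) ^ 2 / ‖A (v i)‖ ^ 2 ≤ 2 := by
  obtain ⟨C, hC⟩ := exists_le_sum_log_norm_sub_log_abs_det v hv hcn h
  let Ψ : {A : E →ₗ[ℝ] E // LinearMap.det A ≠ 0} → ℝ := fun A =>
    c * ∑ i, Real.log ‖A.1 (v i)‖ - Real.log |LinearMap.det A.1|
  have : Nonempty {A : E →ₗ[ℝ] E // LinearMap.det A ≠ 0} := ⟨⟨LinearMap.id, by simp⟩⟩
  have hbdd : BddBelow (Set.range Ψ) := ⟨C, by rintro _ ⟨A, rfl⟩; exact hC A.1 A.2⟩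
  -- Halving the component along a violating direction `e` costs `log 2` through the determinant and
  -- gains more than `3 / 8 * 2` through the norms, so an `A` this close to the infimum of `Ψ` has
  -- no such direction.
  have hδ : 0 < 3 / 4 - Real.log 2 := by linarith [Real.log_two_lt_d9]
  obtain ⟨⟨A, hA⟩, hlt⟩ := exists_lt_of_ciInf_lt (lt_add_of_pos_right (⨅ A, Ψ A) hδ)
  refine ⟨A, hA, fun e he => ?_⟩
  by_contra! hcon
  let B : E →ₗ[ℝ] E := LinearMap.transvection ((-(1 / 2) : ℝ) • innerₛₗ ℝ e) e
  have hBx : ∀ x, B x = x - ((1 / 2 : ℝ) * inner ℝ e x) • e := by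
    intro x
    simp [B, LinearMap.transvection.apply, sub_eq_add_neg]
  have hB : LinearMap.det B = 1 / 2 := by
    simp only [B, LinearMap.transvection.det]
    simp [he]
    norm_num
  have hBn : ∀ x, ‖B x‖ ^ 2 = ‖x‖ ^ 2 - 3 / 4 * inner ℝ e x ^ 2 := by
    intro x
    rw [hBx, norm_sub_sq_real, inner_smul_right, norm_smul, he, real_inner_comm, mul_one,
      Real.norm_eq_abs, sq_abs]
    ring
  have hker : ∀ x, A x = 0 → x = 0 := fun x hx =>
    (LinearMap.equivOfDetNeZero A hA).injective (by simpa using hx)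
  have hdet : LinearMap.det (B ∘ₗ A) = 1 / 2 * LinearMap.det A := by
    rw [LinearMap.det_comp, hB]
  have hlog : ∀ i, Real.log ‖B (A (v i))‖ ≤
      Real.log ‖A (v i)‖ - 3 / 8 * (inner ℝ e (A (v i)) ^ 2 / ‖A (v i)‖ ^ 2) := by
    intro i
    set x := A (v i) with hx
    have hx0 : 0 < ‖x‖ := norm_pos_iff.2 fun h0 => hv i (hker _ h0)
    set t := inner ℝ e x ^ 2 / ‖x‖ ^ 2 with ht
    have ht1 : t ≤ 1 := by
      rw [ht, div_le_one (by positivity)]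
      refine sq_le_sq.2 ?_
      simpa [he] using abs_real_inner_le_norm e x
    have hn : ‖B x‖ ^ 2 = ‖x‖ ^ 2 * (1 - 3 / 4 * t) := by
      rw [hBn, ht]; field_simp
    have h1 : 2 * Real.log ‖B x‖ = 2 * Real.log ‖x‖ + Real.log (1 - 3 / 4 * t) := by
      have := congrArg Real.log hn
      rw [Real.log_mul (by positivity) (by linarith), Real.log_pow, Real.log_pow] at this
      exact_mod_cast this
    have h2 := Real.log_le_sub_one_of_pos (show 0 < 1 - 3 / 4 * t by linarith)
    linarith
  have hstep : Ψ ⟨B ∘ₗ A, by rw [hdet]; positivity⟩ ≤ Ψ ⟨A, hA⟩ - (3 / 4 - Real.log 2) := by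
    have h1 : ∑ i, Real.log ‖B (A (v i))‖ ≤ ∑ i, Real.log ‖A (v i)‖ -
        3 / 8 * ∑ i, (inner ℝ e (A (v i)) ^ 2 / ‖A (v i)‖ ^ 2) := by
      rw [Finset.mul_sum, ← Finset.sum_sub_distrib]
      exact Finset.sum_le_sum fun i _ => hlog i
    have h2 : Real.log |1 / 2 * LinearMap.det A| = Real.log |LinearMap.det A| - Real.log 2 := by
      rw [abs_mul, Real.log_mul (by norm_num) (abs_pos.2 hA).ne', abs_of_pos (by norm_num),
        one_div, Real.log_inv]
      ring
    simp only [Ψ, LinearMap.comp_apply, hdet, h2]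
    nlinarith [mul_le_mul_of_nonneg_left h1 hc]
  have := ciInf_le hbdd ⟨B ∘ₗ A, by rw [hdet]; positivity⟩
  linarith

end RadialIsotropy

/-! ### Separating pairs of arbitrary vectors -/

section PairSplitting

variable {E : Type*} [NormedAddCommGroup E] [InnerProductSpace ℝ E] [FiniteDimensional ℝ E]

open Classical in
-- In isotropic position the squared inner products of normalized vectors sum to at most `2 n² / m`,
-- so by Markov at most `4 n² / m` pairs are nearly parallel. A quarter of the rest is separated.
-- The adjoint of `A` carries the separating vector back without changing signs.
theorem exists_splitting_of_not_concentrated [Nontrivial E] {ι : Type*} [Fintype ι] [Nonempty ι]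
    (v : ι → E) (hv : ∀ i, v i ≠ 0)
    (h : ∀ (W : Submodule ℝ E) (t : Finset ι), (∀ i ∈ t, v i ∈ W) →
      (finrank ℝ E : ℝ) * t.card ≤ Fintype.card ι * finrank ℝ W) (Q : Finset (ι × ι)) :
    ∃ x : E, x ≠ 0 ∧ ((Q.filter fun p => 0 < inner ℝ x (v p.1) * inner ℝ x (v p.2)).card : ℝ) ≤
      3 / 4 * Q.card + (Fintype.card ι : ℝ) ^ 2 / finrank ℝ E := by
  let : MeasurableSpace E := borel E
  have : BorelSpace E := ⟨rfl⟩
  have hn : (0 : ℝ) < Fintype.card ι := by exact_mod_cast Fintype.card_pos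
  have hm : (0 : ℝ) < finrank ℝ E := by exact_mod_cast finrank_pos
  set n : ℝ := (Fintype.card ι : ℝ)
  set m : ℝ := (finrank ℝ E : ℝ)
  obtain ⟨A, hA, hAe⟩ := exists_det_ne_zero_sum_inner_sq_div_le v hv (c := m / n) (by positivity)
    (div_mul_cancel₀ _ hn.ne') fun W t hW => by
      rw [div_mul_eq_mul_div, div_le_iff₀ hn, mul_comm (finrank ℝ W : ℝ)]
      exact h W t hW
  have hbij : Function.Bijective A := (LinearMap.equivOfDetNeZero A hA).bijective
  have hA0 : ∀ i, ‖A (v i)‖ ≠ 0 := fun i h0 =>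
    hv i (hbij.1 (by rw [norm_eq_zero.1 h0, map_zero]))
  let u : ι → E := fun i => ‖A (v i)‖⁻¹ • A (v i)
  have hu : ∀ i, ‖u i‖ = 1 := fun i => by
    simp only [u, norm_smul, norm_inv, norm_norm]
    exact inv_mul_cancel₀ (hA0 i)
  obtain ⟨x, hx0, hx⟩ := exists_splitting_of_norm_eq_one u hu Q
  have hin : ∀ i, inner ℝ (LinearMap.adjoint A x) (v i) = ‖A (v i)‖ * inner ℝ x (u i) := by
    intro i
    rw [LinearMap.adjoint_inner_left]
    simp only [u, inner_smul_right]
    rw [mul_inv_cancel_left₀ (hA0 i)]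
  refine ⟨LinearMap.adjoint A x, fun h0 => hx0 ?_, ?_⟩
  · obtain ⟨y, hy⟩ := hbij.2 x
    have : inner ℝ (LinearMap.adjoint A x) y = (0 : ℝ) := by rw [h0, inner_zero_left]
    rw [LinearMap.adjoint_inner_left, hy] at this
    exact inner_self_eq_zero.1 this
  have hsum : ∑ p : ι × ι, inner ℝ (u p.1) (u p.2) ^ 2 ≤ 2 * n ^ 2 / m := by
    rw [Fintype.sum_prod_type]
    have : ∀ i, ∑ j, inner ℝ (u i) (u j) ^ 2 ≤ 2 * n / m := by
      intro i
      have h1 := hAe (u i) (hu i)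
      have h2 : ∀ j, inner ℝ (u i) (u j) ^ 2 = inner ℝ (u i) (A (v j)) ^ 2 / ‖A (v j)‖ ^ 2 := by
        intro j
        simp only [u, inner_smul_right]
        rw [mul_pow, inv_pow]
        field_simp
      simp only [h2]
      rw [le_div_iff₀ hm]
      rw [div_mul_eq_mul_div, div_le_iff₀ hn] at h1
      linarith
    calc ∑ i, ∑ j, inner ℝ (u i) (u j) ^ 2 ≤ ∑ i : ι, 2 * n / m :=
          Finset.sum_le_sum fun i _ => this i
      _ = 2 * n ^ 2 / m := by
          rw [Finset.sum_const, Finset.card_univ, nsmul_eq_mul]; ring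
  have hbad : ((Q.filter fun p => ¬ inner ℝ (u p.1) (u p.2) ^ 2 ≤ 1 / 2).card : ℝ) ≤
      4 * n ^ 2 / m := by
    have h1 : ((Q.filter fun p => ¬ inner ℝ (u p.1) (u p.2) ^ 2 ≤ 1 / 2).card : ℝ) * (1 / 2) ≤
        ∑ p : ι × ι, inner ℝ (u p.1) (u p.2) ^ 2 := by
      rw [← nsmul_eq_mul]
      refine (Finset.card_nsmul_le_sum _ (fun p : ι × ι => inner ℝ (u p.1) (u p.2) ^ 2) _
        fun p hp => ?_).trans
        (Finset.sum_le_univ_sum_of_nonneg fun p => sq_nonneg _)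
      exact (not_le.1 (Finset.mem_filter.1 hp).2).le
    have h2 : 4 * n ^ 2 / m = 2 * (2 * n ^ 2 / m) := by ring
    linarith
  have hc1 := Finset.card_filter_add_card_filter_not (s := Q)
    (fun p => inner ℝ (u p.1) (u p.2) ^ 2 ≤ 1 / 2)
  have hc2 := Finset.card_filter_add_card_filter_not (s := Q)
    (fun p => inner ℝ x (u p.1) * inner ℝ x (u p.2) ≤ 0)
  have hc3 : (Q.filter fun p => 0 < inner ℝ (LinearMap.adjoint A x) (v p.1) *
      inner ℝ (LinearMap.adjoint A x) (v p.2)) =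
      Q.filter fun p => ¬ inner ℝ x (u p.1) * inner ℝ x (u p.2) ≤ 0 := by
    refine Finset.filter_congr fun p _ => ?_
    rw [hin, hin, not_le, mul_mul_mul_comm]
    have : 0 < ‖A (v p.1)‖ * ‖A (v p.2)‖ := by
      have := hA0 p.1
      have := hA0 p.2
      positivity
    exact mul_pos_iff_of_pos_left this
  rw [hc3]
  rify at hc1 hc2
  have h4 : 4 * n ^ 2 / m = 4 * (n ^ 2 / m) := by ring
  linarith

open Classical in
/-- A linear algebra substitute for ham sandwich theorems: some nonzero vector has inner
products of the same sign with at most about three quarters of the given pairs. -/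
theorem exists_ne_zero_card_filter_inner_mul_inner_pos_le [Nontrivial E] {ι : Type*} [Fintype ι]
    (v : ι → E) (Q : Finset (ι × ι)) :
    ∃ x : E, x ≠ 0 ∧ ((Q.filter fun p => 0 < inner ℝ x (v p.1) * inner ℝ x (v p.2)).card : ℝ) ≤
      3 / 4 * Q.card + (Fintype.card ι : ℝ) ^ 2 / finrank ℝ E := by
  -- Minimize `N U / finrank U` over nonzero `U`: the nonzero projections to a minimizer are not
  -- concentrated.
  let N : Submodule ℝ E → ℕ := fun U => (Finset.univ.filter fun i => v i ∉ Uᗮ).card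
  have hfin : (Set.range fun U : {U : Submodule ℝ E // U ≠ ⊥} =>
      (N U.1 : ℝ) / finrank ℝ U.1).Finite := by
    refine (((Set.finite_Iic (Fintype.card ι)).prod (Set.finite_Iic (finrank ℝ E))).image
      fun p : ℕ × ℕ => (p.1 : ℝ) / p.2).subset ?_
    rintro _ ⟨U, rfl⟩
    exact ⟨(N U.1, finrank ℝ U.1), ⟨Finset.card_le_univ _, Submodule.finrank_le _⟩, rfl⟩
  obtain ⟨_, ⟨⟨U, hU0⟩, rfl⟩, hmin⟩ := Set.exists_min_image _ id hfin
    ⟨_, ⟨⟨⊤, top_ne_bot⟩, rfl⟩⟩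
  replace hmin : ∀ U' : Submodule ℝ E, U' ≠ ⊥ →
      (N U : ℝ) / finrank ℝ U ≤ (N U' : ℝ) / finrank ℝ U' := fun U' hU' =>
    hmin _ ⟨⟨U', hU'⟩, rfl⟩
  have : Nontrivial U := Submodule.nontrivial_iff_ne_bot.2 hU0
  have hm : (0 : ℝ) < finrank ℝ U := by exact_mod_cast finrank_pos
  let P : Type _ := {i // v i ∉ Uᗮ}
  have hPc : Fintype.card P = N U := Fintype.card_subtype _
  have hin : ∀ (x : U) (y : E), inner ℝ (x : E) y = inner ℝ x (U.orthogonalProjectionOnto y) := by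
    intro x y
    exact (Submodule.inner_orthogonalProjectionOnto_eq_of_mem_left x y).symm
  let w : P → U := fun i => U.orthogonalProjectionOnto (v i.1)
  have hw : ∀ i, w i ≠ 0 := fun i h0 =>
    i.2 (Submodule.orthogonalProjectionOnto_eq_zero_iff.1 h0)
  have hperp : ∀ (x : U) (i : ι), v i ∈ Uᗮ → inner ℝ (x : E) (v i) = (0 : ℝ) := fun x i hi =>
    hi x x.2
  by_cases hne : Nonempty P
  · have hcond : ∀ (W : Submodule ℝ U) (t : Finset P), (∀ i ∈ t, w i ∈ W) →
        (finrank ℝ U : ℝ) * t.card ≤ Fintype.card P * finrank ℝ W := by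
      intro W t ht
      by_cases hW : W = ⊤
      · rw [hW, finrank_top, mul_comm]
        gcongr
        exact Finset.card_le_univ _
      -- Vectors projecting into `W` are orthogonal to `U'`, so `N U'` loses at least `t.card`;
      -- comparing with the minimal ratio gives the required bound.
      · let U' : Submodule ℝ E := Wᗮ.map U.subtype
        have hrank : finrank ℝ U' = finrank ℝ Wᗮ :=
          Submodule.finrank_map_subtype_eq U Wᗮ
        have hadd : finrank ℝ W + finrank ℝ Wᗮ = finrank ℝ U := W.finrank_add_finrank_orthogonal
        have hW' : Wᗮ ≠ ⊥ := fun h0 => hW (Submodule.orthogonal_eq_bot_iff.1 h0)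
        have hpos : (0 : ℝ) < finrank ℝ Wᗮ := by
          have := Submodule.nontrivial_iff_ne_bot.2 hW'
          exact_mod_cast finrank_pos
        have hU' : U' ≠ ⊥ := by
          intro h0
          rw [← hrank, h0, finrank_bot] at hpos
          simp at hpos
        have hcard : N U' + t.card ≤ N U := by
          have hdisj : Disjoint (Finset.univ.filter fun i => v i ∉ U'ᗮ)
              (t.map (Function.Embedding.subtype _)) := by
            rw [Finset.disjoint_left]
            intro i hi hit
            obtain ⟨j, hj, rfl⟩ := Finset.mem_map.1 hit
            refine (Finset.mem_filter.1 hi).2 fun y hy => ?_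
            obtain ⟨z, hz, rfl⟩ := hy
            have := hz _ (ht j hj)
            rw [real_inner_comm] at this
            exact (hin z _).trans this
          rw [← Finset.card_map (Function.Embedding.subtype _),
            ← Finset.card_union_of_disjoint hdisj]
          refine Finset.card_le_card fun i hi => ?_
          rcases Finset.mem_union.1 hi with hi | hi
          · refine Finset.mem_filter.2 ⟨Finset.mem_univ _, fun hiU => ?_⟩
            exact (Finset.mem_filter.1 hi).2
              (Submodule.orthogonal_le (Submodule.map_subtype_le _ _) hiU)
          · obtain ⟨j, hj, rfl⟩ := Finset.mem_map.1 hi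
            exact Finset.mem_filter.2 ⟨Finset.mem_univ _, j.2⟩
        have h1 := hmin U' hU'
        rw [hrank, div_le_div_iff₀ hm hpos] at h1
        rw [hPc]
        rify at hadd hcard
        have : (finrank ℝ Wᗮ : ℝ) = finrank ℝ U - finrank ℝ W := by linarith
        rw [this] at h1
        nlinarith
    let Q' : Finset (P × P) := Finset.univ.filter fun p => (p.1.1, p.2.1) ∈ Q
    obtain ⟨x, hx0, hx⟩ := exists_splitting_of_not_concentrated w hw hcond Q'
    let emb : P × P ↪ ι × ι :=
      (Function.Embedding.subtype _).prodMap (Function.Embedding.subtype _)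
    refine ⟨x, by simpa using hx0, ?_⟩
    have hQ' : Q'.card ≤ Q.card := by
      rw [← Finset.card_map emb]
      refine Finset.card_le_card fun p hp => ?_
      obtain ⟨q, hq, rfl⟩ := Finset.mem_map.1 hp
      exact (Finset.mem_filter.1 hq).2
    have hle : (Q.filter fun p => 0 < inner ℝ (x : E) (v p.1) * inner ℝ (x : E) (v p.2)).card ≤
        (Q'.filter fun p => 0 < inner ℝ x (w p.1) * inner ℝ x (w p.2)).card := by
      rw [← Finset.card_map emb]
      refine Finset.card_le_card fun p hp => ?_
      obtain ⟨hpQ, hp⟩ := Finset.mem_filter.1 hp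
      -- Vectors orthogonal to `U` give product zero, so the discarded pairs are never counted.
      have h1 : v p.1 ∉ Uᗮ := fun h0 => by simp [hperp x _ h0] at hp
      have h2 : v p.2 ∉ Uᗮ := fun h0 => by simp [hperp x _ h0] at hp
      refine Finset.mem_map.2 ⟨(⟨p.1, h1⟩, ⟨p.2, h2⟩), ?_, rfl⟩
      refine Finset.mem_filter.2 ⟨Finset.mem_filter.2 ⟨Finset.mem_univ _, hpQ⟩, ?_⟩
      rw [hin, hin] at hp
      exact hp
    have htop := hmin ⊤ top_ne_bot
    rw [finrank_top] at htop
    have hNle : ∀ V, (N V : ℝ) ≤ Fintype.card ι := fun V => by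
      exact_mod_cast Finset.card_le_univ _
    have hEpos : (0 : ℝ) < finrank ℝ E := by exact_mod_cast finrank_pos
    have hsq : (Fintype.card P : ℝ) ^ 2 / finrank ℝ U ≤
        (Fintype.card ι : ℝ) ^ 2 / finrank ℝ E := by
      rw [hPc]
      calc (N U : ℝ) ^ 2 / finrank ℝ U = N U * (N U / finrank ℝ U) := by ring
        _ ≤ Fintype.card ι * (Fintype.card ι / finrank ℝ E) := by
          refine mul_le_mul (hNle U) (htop.trans ?_) (by positivity) (by positivity)
          exact div_le_div_of_nonneg_right (hNle ⊤) hEpos.le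
        _ = _ := by ring
    have hQr : (Q'.card : ℝ) ≤ Q.card := by exact_mod_cast hQ'
    have hler : ((Q.filter fun p =>
        0 < inner ℝ (x : E) (v p.1) * inner ℝ (x : E) (v p.2)).card : ℝ) ≤
        (Q'.filter fun p => 0 < inner ℝ x (w p.1) * inner ℝ x (w p.2)).card := by
      exact_mod_cast hle
    linarith
  · obtain ⟨x, hx0⟩ := exists_ne (0 : U)
    refine ⟨x, by simpa using hx0, ?_⟩
    rw [Finset.filter_false_of_mem]
    · simp only [Finset.card_empty, Nat.cast_zero]
      positivity
    · intro p _
      have h1 : v p.1 ∈ Uᗮ := by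
        by_contra h0
        exact hne ⟨⟨p.1, h0⟩⟩
      simp [hperp x _ h1]

end PairSplitting

/-! ### Polynomial partitioning by pairs -/

section Partitioning

theorem exists_mvPolynomial_card_filter_eval_mul_eval_pos_le (d : ℕ) {j : ℕ} (hj : 1 ≤ j)
    (P : Finset (Fin d → ℝ)) (Q : Finset ((Fin d → ℝ) × (Fin d → ℝ))) (hQ : Q ⊆ P ×ˢ P) :
    ∃ f : MvPolynomial (Fin d) ℝ, f ≠ 0 ∧ f.totalDegree ≤ d * j ∧
      ((Q.filter fun p => 0 < MvPolynomial.eval p.1 f * MvPolynomial.eval p.2 f).card : ℝ) ≤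
        3 / 4 * Q.card + (P.card : ℝ) ^ 2 / (j : ℝ) ^ d := by
  classical
  let E := EuclideanSpace ℝ (Fin d → Fin j)
  have hrank : finrank ℝ E = j ^ d := by simp [E]
  have : Nontrivial E := nontrivial_of_finrank_pos (R := ℝ) (by rw [hrank]; positivity)
  let expo : (Fin d → Fin j) → (Fin d →₀ ℕ) := fun α =>
    Finsupp.equivFunOnFinite.symm fun i => (α i : ℕ)
  have hexpo : Function.Injective expo := by
    intro α β h
    ext i
    exact DFunLike.congr_fun h i
  let v : P → E := fun p => WithLp.toLp 2 fun α => (expo α).prod fun i k => p.1 i ^ k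
  let Q' : Finset (P × P) := Finset.univ.filter fun p => (p.1.1, p.2.1) ∈ Q
  obtain ⟨x, hx0, hx⟩ := exists_ne_zero_card_filter_inner_mul_inner_pos_le v Q'
  let f : MvPolynomial (Fin d) ℝ := ∑ α, MvPolynomial.monomial (expo α) (x α)
  have heval : ∀ p : P, MvPolynomial.eval p.1 f = inner ℝ x (v p) := by
    intro p
    simp only [f, map_sum, MvPolynomial.eval_monomial, v]
    refine Finset.sum_congr rfl fun α _ => ?_
    simp [mul_comm]
  let emb : P × P ↪ (Fin d → ℝ) × (Fin d → ℝ) :=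
    (Function.Embedding.subtype _).prodMap (Function.Embedding.subtype _)
  refine ⟨f, fun hf0 => hx0 ?_, ?_, ?_⟩
  · ext α
    have h1 : MvPolynomial.coeff (expo α) f = x α := by
      simp only [f, MvPolynomial.coeff_sum, MvPolynomial.coeff_monomial, hexpo.eq_iff]
      simp
    rw [← h1, hf0]
    simp
  · refine MvPolynomial.totalDegree_finsetSum_le fun α _ =>
      (MvPolynomial.totalDegree_monomial_le _ _).trans ?_
    rw [Finsupp.sum_fintype _ _ (fun _ => rfl)]
    calc ∑ i, expo α i ≤ ∑ _i : Fin d, j := Finset.sum_le_sum fun i _ => (α i).2.le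
      _ = d * j := by simp
  · have h1 : (Q.filter fun p => 0 < MvPolynomial.eval p.1 f * MvPolynomial.eval p.2 f).card ≤
        (Q'.filter fun p => 0 < inner ℝ x (v p.1) * inner ℝ x (v p.2)).card := by
      rw [← Finset.card_map emb]
      refine Finset.card_le_card fun p hp => ?_
      obtain ⟨hpQ, hp⟩ := Finset.mem_filter.1 hp
      obtain ⟨hp1, hp2⟩ := Finset.mem_product.1 (hQ hpQ)
      refine Finset.mem_map.2 ⟨(⟨p.1, hp1⟩, ⟨p.2, hp2⟩), ?_, rfl⟩
      refine Finset.mem_filter.2 ⟨Finset.mem_filter.2 ⟨Finset.mem_univ _, hpQ⟩, ?_⟩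
      rw [← heval, ← heval]
      exact hp
    have h2 : Q'.card ≤ Q.card := by
      rw [← Finset.card_map emb]
      refine Finset.card_le_card fun p hp => ?_
      obtain ⟨q, hq, rfl⟩ := Finset.mem_map.1 hp
      exact (Finset.mem_filter.1 hq).2
    rify at h1 h2
    rw [hrank, Fintype.card_coe] at hx
    push_cast at hx
    linarith

open Classical in
/-- The pairs of points of `P` that are joined by a segment avoiding the zero set of `f`. -/
noncomputable def visiblePairs {d : ℕ} (P : Finset (Fin d → ℝ)) (f : MvPolynomial (Fin d) ℝ) :
    Finset ((Fin d → ℝ) × (Fin d → ℝ)) :=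
  (P ×ˢ P).filter fun p => ∀ x ∈ segment ℝ p.1 p.2, MvPolynomial.eval x f ≠ 0

theorem eval_mul_eval_pos_of_segment {d : ℕ} {f : MvPolynomial (Fin d) ℝ} {p q : Fin d → ℝ}
    (h : ∀ x ∈ segment ℝ p q, MvPolynomial.eval x f ≠ 0) :
    0 < MvPolynomial.eval p f * MvPolynomial.eval q f := by
  have hc : ContinuousOn (fun x => MvPolynomial.eval x f) (segment ℝ p q) :=
    (MvPolynomial.continuous_eval f).continuousOn
  have hpre : IsPreconnected (segment ℝ p q) := (convex_segment p q).isPreconnected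
  by_contra! hcon
  rcases mul_nonpos_iff.1 hcon with ⟨h1, h2⟩ | ⟨h1, h2⟩
  · obtain ⟨x, hx, hx0⟩ := hpre.intermediate_value (right_mem_segment ℝ p q)
      (left_mem_segment ℝ p q) hc ⟨h2, h1⟩
    exact h x hx hx0
  · obtain ⟨x, hx, hx0⟩ := hpre.intermediate_value (left_mem_segment ℝ p q)
      (right_mem_segment ℝ p q) hc ⟨h1, h2⟩
    exact h x hx hx0

/-- Multiply `f` by a polynomial splitting its visible pairs: a pair visible for the product is
visible for `f` and has equal signs under the new factor. -/
theorem exists_mul_card_visiblePairs_le {d j : ℕ} (hj : 1 ≤ j) (P : Finset (Fin d → ℝ))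
    {f : MvPolynomial (Fin d) ℝ} (hf : 0 < f.totalDegree) :
    ∃ g : MvPolynomial (Fin d) ℝ, 0 < g.totalDegree ∧ g.totalDegree ≤ f.totalDegree + d * j ∧
      ((visiblePairs P g).card : ℝ) ≤
        3 / 4 * (visiblePairs P f).card + (P.card : ℝ) ^ 2 / (j : ℝ) ^ d := by
  classical
  have hf0 : f ≠ 0 := by rintro rfl; simp at hf
  obtain ⟨g, hg0, hgd, hg⟩ := exists_mvPolynomial_card_filter_eval_mul_eval_pos_le d hj P
    (visiblePairs P f) (Finset.filter_subset _ _)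
  refine ⟨f * g, ?_, (MvPolynomial.totalDegree_mul _ _).trans (by omega), le_trans ?_ hg⟩
  · rw [MvPolynomial.totalDegree_mul_of_isDomain hf0 hg0]
    omega
  · refine Nat.cast_le.2 (Finset.card_le_card fun p hp => ?_)
    obtain ⟨hpP, hp⟩ := Finset.mem_filter.1 hp
    simp only [map_mul, mul_ne_zero_iff] at hp
    exact Finset.mem_filter.2 ⟨Finset.mem_filter.2 ⟨hpP, fun x hx => (hp x hx).1⟩,
      eval_mul_eval_pos_of_segment fun x hx => (hp x hx).2⟩

theorem exists_card_visiblePairs_le_pow {d j : ℕ} (hj : 1 ≤ j) (P : Finset (Fin d → ℝ))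
    {f : MvPolynomial (Fin d) ℝ} (hf : 0 < f.totalDegree) (t : ℕ) :
    ∃ g : MvPolynomial (Fin d) ℝ, 0 < g.totalDegree ∧
      g.totalDegree ≤ f.totalDegree + t * (d * j) ∧
      ((visiblePairs P g).card : ℝ) ≤
        (3 / 4) ^ t * (visiblePairs P f).card + 4 * ((P.card : ℝ) ^ 2 / (j : ℝ) ^ d) := by
  induction t with
  | zero => exact ⟨f, hf, by simp, by simp only [pow_zero, one_mul]; simp; positivity⟩
  | succ t ih =>
    obtain ⟨g, hg, hgd, hgc⟩ := ih
    obtain ⟨h, hh, hhd, hhc⟩ := exists_mul_card_visiblePairs_le hj P hg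
    refine ⟨h, hh, hhd.trans (by rw [add_mul, one_mul]; omega), hhc.trans ?_⟩
    rw [pow_succ (3 / 4 : ℝ)]
    linarith

/-- A polynomial partitioning theorem, counting pairs of points in a common cell. -/
theorem exists_partitioning_mvPolynomial {d : ℕ} (hd : 0 < d) :
    ∃ C : ℕ, 0 < C ∧ ∀ (P : Finset (Fin d → ℝ)) (s : ℕ), ∃ f : MvPolynomial (Fin d) ℝ,
      0 < f.totalDegree ∧ f.totalDegree ≤ C * 2 ^ s ∧
      ((visiblePairs P f).card : ℝ) ≤ 8 * ((P.card : ℝ) ^ 2 / ((2 : ℝ) ^ s) ^ d) := by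
  obtain ⟨t, ht⟩ := exists_pow_lt_of_lt_one (show (0 : ℝ) < 1 / (2 * 2 ^ d) by positivity)
    (show (3 / 4 : ℝ) < 1 by norm_num)
  -- Passing from `s` to `s + 1` costs degree `t * d * 2 ^ (s + 1)`, at most `C * 2 ^ s`. The choice
  -- of `t` shrinks the inherited pairs to `4 y`, and the geometric error series adds another `4 y`.
  refine ⟨2 * t * d + 1, by omega, fun P s => ?_⟩
  induction s with
  | zero =>
    refine ⟨MvPolynomial.X ⟨0, hd⟩, by simp, by simp, ?_⟩
    have h1 : (visiblePairs P (MvPolynomial.X ⟨0, hd⟩)).card ≤ P.card * P.card := by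
      classical
      rw [← Finset.card_product]
      exact Finset.card_filter_le _ _
    rify at h1
    simp only [pow_zero, one_pow, div_one]
    nlinarith [sq_nonneg (P.card : ℝ)]
  | succ s ih =>
    obtain ⟨f, hf, hfd, hfc⟩ := ih
    obtain ⟨g, hg, hgd, hgc⟩ := exists_card_visiblePairs_le_pow (j := 2 ^ (s + 1))
      Nat.one_le_two_pow P hf t
    refine ⟨g, hg, ?_, hgc.trans ?_⟩
    · refine (hgd.trans (Nat.add_le_add_right hfd _)).trans ?_
      have : 1 ≤ 2 ^ s := Nat.one_le_two_pow
      rw [pow_succ]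
      nlinarith
    · push_cast
      set n2 := (P.card : ℝ) ^ 2
      have hA : n2 / ((2 : ℝ) ^ s) ^ d = 2 ^ d * (n2 / ((2 : ℝ) ^ (s + 1)) ^ d) := by
        rw [pow_succ, mul_pow]
        field_simp
      rw [hA] at hfc
      set y := n2 / ((2 : ℝ) ^ (s + 1)) ^ d
      have hy : 0 ≤ y := by positivity
      rw [lt_div_iff₀ (by positivity)] at ht
      have h1 := mul_le_mul_of_nonneg_left hfc (show (0 : ℝ) ≤ (3 / 4) ^ t by positivity)
      nlinarith [mul_le_mul_of_nonneg_right ht.le hy]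

end Partitioning

/-! ### Visible pairs on rich lines -/

section RichLines

variable {d : ℕ}

theorem IsLine.direction_eq_span {l : AffineSubspace ℝ (Fin d → ℝ)} (hl : IsLine l)
    {b : Fin d → ℝ} (hb : b ∈ l.direction) (hb0 : b ≠ 0) :
    l.direction = Submodule.span ℝ {b} := by
  refine (Submodule.eq_of_le_of_finrank_eq ?_ ?_).symm
  · rwa [Submodule.span_singleton_le_iff_mem]
  · rw [finrank_span_singleton hb0]
    exact hl.symm

theorem IsLine.eq_of_mem {l l' : AffineSubspace ℝ (Fin d → ℝ)} (hl : IsLine l) (hl' : IsLine l')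
    {p q : Fin d → ℝ} (hpq : p ≠ q) (hp : p ∈ l) (hq : q ∈ l) (hp' : p ∈ l') (hq' : q ∈ l') :
    l = l' := by
  have h0 : q -ᵥ p ≠ 0 := fun h => hpq (vsub_eq_zero_iff_eq.1 h).symm
  refine AffineSubspace.ext_of_direction_eq ?_ ⟨p, hp, hp'⟩
  rw [hl.direction_eq_span (AffineSubspace.vsub_mem_direction hq hp) h0,
    hl'.direction_eq_span (AffineSubspace.vsub_mem_direction hq' hp') h0]

open Classical in
/-- The pairs in `Q` of distinct points of `l`. -/
noncomputable def pairsOnLine (Q : Finset ((Fin d → ℝ) × (Fin d → ℝ)))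
    (l : AffineSubspace ℝ (Fin d → ℝ)) : Finset ((Fin d → ℝ) × (Fin d → ℝ)) :=
  Q.filter fun p => p.1 ∈ l ∧ p.2 ∈ l ∧ p.1 ≠ p.2

theorem card_mul_le_of_le_card_pairsOnLine (Q : Finset ((Fin d → ℝ) × (Fin d → ℝ)))
    (B : Finset (AffineSubspace ℝ (Fin d → ℝ))) (hB : ∀ l ∈ B, IsLine l) {k : ℝ}
    (hk : ∀ l ∈ B, k ≤ (pairsOnLine Q l).card) : B.card * k ≤ Q.card := by
  classical
  have hdisj : (B : Set (AffineSubspace ℝ (Fin d → ℝ))).PairwiseDisjoint (pairsOnLine Q) := by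
    intro l hl l' hl' hne
    rw [Function.onFun, Finset.disjoint_left]
    intro p hp hp'
    obtain ⟨-, h1, h2, h3⟩ := Finset.mem_filter.1 hp
    obtain ⟨-, h1', h2', -⟩ := Finset.mem_filter.1 hp'
    exact hne ((hB l hl).eq_of_mem (hB l' hl') h3 h1 h2 h1' h2')
  have hle : (B.biUnion (pairsOnLine Q)).card ≤ Q.card :=
    Finset.card_le_card (Finset.biUnion_subset.2 fun l _ => Finset.filter_subset _ _)
  rw [Finset.card_biUnion hdisj] at hle
  rify at hle
  rw [← nsmul_eq_mul]
  exact (Finset.card_nsmul_le_sum _ _ _ hk).trans hle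

/-- The restriction of a polynomial to a parametrized line. -/
theorem exists_polynomial_eval_eq (f : MvPolynomial (Fin d) ℝ) (a b : Fin d → ℝ) :
    ∃ g : Polynomial ℝ, g.natDegree ≤ f.totalDegree ∧
      ∀ t, g.eval t = MvPolynomial.eval (a + t • b) f := by
  refine ⟨MvPolynomial.aeval
    (fun i => Polynomial.C (a i) + Polynomial.X * Polynomial.C (b i)) f, ?_, fun t => ?_⟩
  · have := MvPolynomial.aeval_natDegree_le (m := f.totalDegree) (n := 1) f le_rfl
      (fun i => Polynomial.C (a i) + Polynomial.X * Polynomial.C (b i)) fun i => by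
        compute_degree
    simpa using this
  · rw [← Polynomial.coe_evalRingHom, MvPolynomial.aeval_def, MvPolynomial.hom_eval₂,
      MvPolynomial.eval, MvPolynomial.coe_eval₂Hom]
    congr 1
    · ext; simp
    · ext i; simp [mul_comm t]

/-- On a line not contained in the zero set of `f`, most points are joined to another one by a
segment avoiding this zero set. -/
theorem ncard_le_card_pairsOnLine_visiblePairs (P : Finset (Fin d → ℝ))
    (f : MvPolynomial (Fin d) ℝ) {l : AffineSubspace ℝ (Fin d → ℝ)} (hl : IsLine l)
    (hlf : ¬ (l : Set (Fin d → ℝ)) ⊆ {x | MvPolynomial.eval x f = 0}) :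
    ((P : Set (Fin d → ℝ)) ∩ (l : Set (Fin d → ℝ))).ncard ≤
      (pairsOnLine (visiblePairs P f) l).card + 2 * f.totalDegree + 1 := by
  classical
  obtain ⟨a, hal, haf⟩ := Set.not_subset.1 hlf
  obtain ⟨b, hb0, hb⟩ := finrank_eq_one_iff'.1 hl
  have hb0' : (b : Fin d → ℝ) ≠ 0 := by simpa using hb0
  have hpar : ∀ p ∈ l, ∃ t : ℝ, p = a + t • (b : Fin d → ℝ) := by
    intro p hp
    obtain ⟨t, ht⟩ := hb ⟨p -ᵥ a, AffineSubspace.vsub_mem_direction hp hal⟩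
    refine ⟨t, ?_⟩
    have h1 : t • (b : Fin d → ℝ) = p - a := congrArg Subtype.val ht
    rw [h1]; abel
  obtain ⟨g, hgd, hg⟩ := exists_polynomial_eval_eq f a b
  have hg0 : g ≠ 0 := by
    rintro rfl
    apply haf
    have := hg 0
    simpa using this.symm
  choose! τ hτ using hpar
  have hτi : ∀ p ∈ l, ∀ q ∈ l, τ p = τ q → p = q := fun p hp q hq h => by
    rw [hτ p hp, hτ q hq, h]
  set R := g.roots.toFinset with hR
  have hRm : ∀ t, t ∈ R ↔ MvPolynomial.eval (a + t • (b : Fin d → ℝ)) f = 0 := by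
    intro t
    rw [hR, Multiset.mem_toFinset, Polynomial.mem_roots hg0, Polynomial.IsRoot, hg]
  have hRc : R.card ≤ f.totalDegree :=
    (Multiset.toFinset_card_le _).trans ((Polynomial.card_roots' _).trans hgd)
  set Pl := P.filter fun p => p ∈ l with hPl
  have hncard : ((P : Set (Fin d → ℝ)) ∩ (l : Set (Fin d → ℝ))).ncard = Pl.card := by
    rw [← Set.ncard_coe_finset, hPl, Finset.coe_filter]
    rfl
  set A := Pl.filter fun p => MvPolynomial.eval p f ≠ 0 with hA
  have hAl : ∀ p ∈ A, p ∈ P ∧ p ∈ l ∧ MvPolynomial.eval p f ≠ 0 := by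
    intro p hp
    obtain ⟨hp1, hp2⟩ := Finset.mem_filter.1 hp
    obtain ⟨hp3, hp4⟩ := Finset.mem_filter.1 hp1
    exact ⟨hp3, hp4, hp2⟩
  have hzero : (Pl.filter fun p => ¬ MvPolynomial.eval p f ≠ 0).card ≤ R.card := by
    refine Finset.card_le_card_of_injOn τ (fun p hp => ?_) fun p hp q hq h => ?_
    · obtain ⟨hp1, hp2⟩ := Finset.mem_filter.1 hp
      rw [Finset.mem_coe, hRm, ← hτ p (Finset.mem_filter.1 hp1).2]
      exact not_not.1 hp2
    · exact hτi p (Finset.mem_filter.1 (Finset.mem_filter.1 hp).1).2 q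
        (Finset.mem_filter.1 (Finset.mem_filter.1 hq).1).2 h
  have hsplit := Finset.card_filter_add_card_filter_not (s := Pl)
    (fun p => MvPolynomial.eval p f ≠ 0)
  rw [← hA] at hsplit
  -- The number of zeros before `p` labels its interval: a zero between two points of `A` would make
  -- their labels differ.
  let κ : (Fin d → ℝ) → ℕ := fun p => (R.filter fun t => t < τ p).card
  have hvis' : ∀ p ∈ A, ∀ q ∈ A, κ p = κ q → τ p ≤ τ q →
      ∀ x ∈ segment ℝ p q, MvPolynomial.eval x f ≠ 0 := by
    rintro p hp q hq hκ hpq x ⟨α, β, hα, hβ, hαβ, rfl⟩ hx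
    obtain ⟨-, hpl, hpf⟩ := hAl p hp
    obtain ⟨-, hql, hqf⟩ := hAl q hq
    set t := α * τ p + β * τ q with ht
    have hxt : α • p + β • q = a + t • (b : Fin d → ℝ) := by
      conv_lhs => rw [hτ p hpl, hτ q hql]
      have : a = (α + β) • a := by rw [hαβ, one_smul]
      conv_rhs => rw [this]
      rw [ht]
      module
    have htR : t ∈ R := by rw [hRm, ← hxt]; exact hx
    have hα' : α = 1 - β := by linarith
    have ht1 : τ p ≤ t := by rw [ht, hα']; nlinarith
    have ht2 : t ≤ τ q := by rw [ht, hα']; nlinarith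
    have ht3 : t ≠ τ q := fun h => hqf (by rw [hτ q hql, ← hRm, ← h]; exact htR)
    refine hκ.not_lt (Finset.card_lt_card ?_)
    rw [Finset.ssubset_iff_of_subset]
    · exact ⟨t, Finset.mem_filter.2 ⟨htR, lt_of_le_of_ne ht2 ht3⟩, fun h =>
        (Finset.mem_filter.1 h).2.not_ge ht1⟩
    · exact fun y hy => Finset.mem_filter.2
        ⟨(Finset.mem_filter.1 hy).1, (Finset.mem_filter.1 hy).2.trans_le hpq⟩
  have hvis : ∀ p ∈ A, ∀ q ∈ A, κ p = κ q → (p, q) ∈ visiblePairs P f := by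
    intro p hp q hq hκ
    refine Finset.mem_filter.2 ⟨Finset.mem_product.2 ⟨(hAl p hp).1, (hAl q hq).1⟩, ?_⟩
    rcases le_total (τ p) (τ q) with h | h
    · exact hvis' p hp q hq hκ h
    · intro x hx
      rw [segment_symm] at hx
      exact hvis' q hq p hp hκ.symm h x hx
  -- `A'` has one representative per occupied interval. Every other point of `A` forms a visible
  -- pair with its representative, so only zeros and representatives are lost.
  obtain ⟨A', hA'A, hinj, himg⟩ := Finset.exists_subset_injOn_image_eq_of_surjOn
    (f := κ) (s := A) (t := A.image κ) (by rw [Finset.coe_image]; exact Set.surjOn_image _ _)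
  have hA'c : A'.card ≤ f.totalDegree + 1 := by
    rw [← Finset.card_image_of_injOn hinj, himg]
    refine (Finset.card_le_card (t := Finset.range (R.card + 1)) ?_).trans (by simpa using hRc)
    intro k hk
    obtain ⟨p, -, rfl⟩ := Finset.mem_image.1 hk
    exact Finset.mem_range.2 (Nat.lt_succ_of_le (Finset.card_filter_le _ _))
  have hrep : ∀ p ∈ A, ∃ q ∈ A', κ q = κ p := by
    intro p hp
    have : κ p ∈ A'.image κ := by rw [himg]; exact Finset.mem_image_of_mem _ hp
    exact Finset.mem_image.1 this
  choose! ψ hψA hψ using hrep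
  have hpairs : (A \ A').card ≤ (pairsOnLine (visiblePairs P f) l).card := by
    refine Finset.card_le_card_of_injOn (fun p => (ψ p, p)) (fun p hp => ?_)
      fun p _ q _ h => congrArg Prod.snd h
    obtain ⟨hp1, hp2⟩ := Finset.mem_sdiff.1 hp
    have hq := hψA p hp1
    refine Finset.mem_filter.2 ⟨hvis _ (hA'A hq) _ hp1 (hψ p hp1), (hAl _ (hA'A hq)).2.1,
      (hAl _ hp1).2.1, fun h => hp2 ?_⟩
    exact (show ψ p = p from h) ▸ hq
  have hsd := Finset.card_sdiff_add_card_eq_card hA'A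
  omega

end RichLines

/-! ### Choice of scale and conclusion -/

theorem theorem2p1 (d : ℕ) :
    ∃ K : ℝ, 0 < K ∧
      ∀ (n r : ℕ) (P : Finset (Fin d → ℝ)) (L : Set (AffineSubspace ℝ (Fin d → ℝ))),
        1 ≤ n → 2 ≤ r → P.card = n →
        (∀ l ∈ L, IsLine l ∧ r ≤ ((P : Set (Fin d → ℝ)) ∩ (l : Set (Fin d → ℝ))).ncard) →
        K * ((n : ℝ) ^ 2 / (r : ℝ) ^ (d + 1)) ≤ (L.ncard : ℝ) →
        ∃ Z : Set (Fin d → ℝ), IsHypersurfaceOfDegreeLE Z ((r : ℝ) / 4) ∧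
          4 * ((n : ℝ) ^ 2 / (r : ℝ) ^ (d + 1)) ≤
            ({l ∈ L | (l : Set (Fin d → ℝ)) ⊆ Z}.ncard : ℝ) := by
  classical
  rcases Nat.eq_zero_or_pos d with rfl | hd
  · refine ⟨1, one_pos, fun n r P L hn hr hP hL hK => ?_⟩
    have hL0 : L = ∅ := by
      refine Set.eq_empty_of_forall_notMem fun l hl => ?_
      have h1 := (hL l hl).1
      have h2 := Submodule.finrank_le l.direction
      rw [h1] at h2
      simp at h2
    have : (0 : ℝ) < 1 * ((n : ℝ) ^ 2 / (r : ℝ) ^ (0 + 1)) := by positivity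
    rw [hL0, Set.ncard_empty, Nat.cast_zero] at hK
    linarith
  obtain ⟨C, hC, hpart⟩ := exists_partitioning_mvPolynomial hd
  -- At most `32 * (8 * C) ^ d * y` lines escape the zero set, and 4 is the multiple of `y` to be
  -- kept. The exponent `d + 1` rules out `r < 4 * C`, where `K * y` would exceed `n²`, hence the
  -- number of lines.
  refine ⟨32 * (8 * C) ^ (d + 1) + 4, by positivity, fun n r P L hn hr hP hL hK => ?_⟩
  have hn0 : (0 : ℝ) < n := by exact_mod_cast hn
  have hr0 : (0 : ℝ) < r := by exact_mod_cast (by omega : 0 < r)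
  have hC1 : (1 : ℝ) ≤ C := by exact_mod_cast hC
  set y : ℝ := (n : ℝ) ^ 2 / (r : ℝ) ^ (d + 1) with hy
  have hy0 : 0 < y := by positivity
  have hLfin : L.Finite := by
    -- An infinite `L` would have `ncard` equal to 0, against the positive lower bound.
    refine Set.finite_of_ncard_ne_zero fun h0 => ?_
    rw [h0, Nat.cast_zero] at hK
    have : 0 < (32 * (8 * (C : ℝ)) ^ (d + 1) + 4) * y := by positivity
    linarith
  lift L to Finset (AffineSubspace ℝ (Fin d → ℝ)) using hLfin
  rw [Set.ncard_coe_finset] at hK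
  simp only [Finset.mem_coe] at hL
  have hLn : (L.card : ℝ) ≤ (n : ℝ) ^ 2 := by
    have h1 := card_mul_le_of_le_card_pairsOnLine (P ×ˢ P) L (fun l hl => (hL l hl).1) (k := 1)
      fun l hl => by
        have h2 : 1 < ((P : Set (Fin d → ℝ)) ∩ (l : Set (Fin d → ℝ))).ncard :=
          lt_of_lt_of_le (by omega) (hL l hl).2
        obtain ⟨p, hp, q, hq, hpq⟩ :=
          (Set.one_lt_ncard (P.finite_toSet.subset Set.inter_subset_left)).1 h2
        have h3 : (p, q) ∈ pairsOnLine (P ×ˢ P) l :=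
          Finset.mem_filter.2 ⟨Finset.mem_product.2 ⟨hp.1, hq.1⟩, hp.2, hq.2, hpq⟩
        exact_mod_cast Finset.card_pos.2 ⟨_, h3⟩
    rw [Finset.card_product, hP] at h1
    push_cast at h1
    linarith
  have hrC : 4 * C ≤ r := by
    by_contra! hlt
    have h1 : (r : ℝ) ≤ 8 * C := by
      have : (r : ℝ) < 4 * C := by exact_mod_cast hlt
      linarith
    have h2 : (r : ℝ) ^ (d + 1) ≤ (8 * C) ^ (d + 1) := pow_le_pow_left₀ hr0.le h1 _
    have h3 : (n : ℝ) ^ 2 = (r : ℝ) ^ (d + 1) * y := by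
      rw [hy]; field_simp
    have h4 : (r : ℝ) ^ (d + 1) * y ≤ (8 * C) ^ (d + 1) * y :=
      mul_le_mul_of_nonneg_right h2 hy0.le
    have h5 : 0 < (8 * (C : ℝ)) ^ (d + 1) * y := by positivity
    linarith
  obtain ⟨s, hs1, hs2⟩ : ∃ s : ℕ, 4 * C * 2 ^ s ≤ r ∧ r < 4 * C * 2 ^ (s + 1) := by
    have hq : r / (4 * C) ≠ 0 := by
      have := Nat.div_pos hrC (by omega)
      omega
    refine ⟨Nat.log 2 (r / (4 * C)), ?_, ?_⟩
    · have h1 := Nat.pow_log_le_self 2 hq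
      calc 4 * C * 2 ^ Nat.log 2 (r / (4 * C)) ≤ 4 * C * (r / (4 * C)) := Nat.mul_le_mul_left _ h1
        _ ≤ r := Nat.mul_div_le _ _
    · have h1 := Nat.lt_pow_succ_log_self one_lt_two (r / (4 * C))
      rw [Nat.div_lt_iff_lt_mul (by omega)] at h1
      rwa [mul_comm]
  obtain ⟨f, hf0, hfd, hfc⟩ := hpart P s
  have hfr : 4 * f.totalDegree ≤ r := by nlinarith
  refine ⟨{x | MvPolynomial.eval x f = 0}, ⟨f, hf0, ?_, rfl⟩, ?_⟩
  · rify at hfr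
    linarith
  have hsub : {l ∈ (L : Set (AffineSubspace ℝ (Fin d → ℝ))) |
      (l : Set (Fin d → ℝ)) ⊆ {x | MvPolynomial.eval x f = 0}} =
      ((L.filter fun l : AffineSubspace ℝ (Fin d → ℝ) =>
        (l : Set (Fin d → ℝ)) ⊆ {x | MvPolynomial.eval x f = 0} : Finset _) : Set _) := by
    rw [Finset.coe_filter]
    rfl
  rw [hsub, Set.ncard_coe_finset]
  have hsplit := Finset.card_filter_add_card_filter_not (s := L)
    (fun l : AffineSubspace ℝ (Fin d → ℝ) =>
      (l : Set (Fin d → ℝ)) ⊆ {x | MvPolynomial.eval x f = 0})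
  rify at hsplit
  set B := L.filter fun l : AffineSubspace ℝ (Fin d → ℝ) =>
    ¬ (l : Set (Fin d → ℝ)) ⊆ {x | MvPolynomial.eval x f = 0} with hB
  -- Each escaping line has at least `r - 2 deg f - 1 ≥ r / 2 - 1 ≥ r / 4` visible pairs, as `r ≥
  -- 4`.
  have hBc := card_mul_le_of_le_card_pairsOnLine (visiblePairs P f) B
    (fun l hl => (hL l (Finset.mem_filter.1 hl).1).1) (k := (r : ℝ) / 4) fun l hl => by
      obtain ⟨hlL, hlf⟩ := Finset.mem_filter.1 hl
      have h1 := (hL l hlL).2.trans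
        (ncard_le_card_pairsOnLine_visiblePairs P f (hL l hlL).1 hlf)
      have h2 : (4 : ℝ) ≤ r := by exact_mod_cast (by omega : 4 ≤ r)
      rify at h1 hfr
      linarith
  have hpow : (r : ℝ) ^ d ≤ (8 * C) ^ d * ((2 : ℝ) ^ s) ^ d := by
    rw [← mul_pow]
    refine pow_le_pow_left₀ hr0.le ?_ _
    rify at hs2
    rw [pow_succ] at hs2
    linarith
  have hfin : (B.card : ℝ) ≤ 32 * (8 * C) ^ d * y := by
    rw [hP] at hfc
    have h1 : (n : ℝ) ^ 2 / ((2 : ℝ) ^ s) ^ d ≤ (8 * C) ^ d * (y * r) := by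
      rw [div_le_iff₀ (by positivity)]
      have h3 : (n : ℝ) ^ 2 = (r : ℝ) ^ d * (y * r) := by
        rw [hy]; field_simp; exact pow_succ _ _
      rw [h3]
      calc (r : ℝ) ^ d * (y * r) ≤ ((8 * C) ^ d * ((2 : ℝ) ^ s) ^ d) * (y * r) :=
            mul_le_mul_of_nonneg_right hpow (by positivity)
        _ = _ := by ring
    refine le_of_mul_le_mul_right ?_ hr0
    nlinarith
  have hCd : (8 * (C : ℝ)) ^ d ≤ (8 * C) ^ (d + 1) :=
    pow_le_pow_right₀ (by linarith) (Nat.le_succ d)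
  have := mul_le_mul_of_nonneg_right hCd hy0.le
  linarith
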